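/- All graphs are finite and simple. A median of a triple of vertices $u,v,w$ of a graph is a vertex that lies simultaneously on a shortest $u,v$-path, a shortest $u,w$-path and a shortest $v,w$-path; a nonempty graph is a median graph if every triple of its (not necessarily distinct) vertices has a unique median. For $n\ge 0$ the $n$-cube $Q_n$ is the graph whose vertices are the binary strings of length $n$, two strings being adjacent if they differ in exactly one position, and $\alpha_n(G)$ denotes the number of induced subgraphs of $G$ that are isomorphic to $Q_n$. Let $G$ be a median graph and let $m$ be the largest integer $n\ge 0$ such that $G$ contains an induced subgraph isomorphic to $Q_n$. Then $$\alpha_m(G)<\alpha_{m-1}(G)<\cdots<\alpha_{\lceil (m-1)/2\rceil}(G),$$ that is, $\alpha_{i+1}(G)<\alpha_i(G)$ for every integer $i$ with $\lceil (m-1)/2\rceil\le i<m$. -/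

import Mathlib

/-- The `n`-cube `Q_n`: its vertices are the binary strings of length `n`, and two strings are
adjacent when they differ in exactly one position. -/
def hypercube (n : ℕ) : SimpleGraph (Fin n → Bool) where
  Adj x y := ∃! i, x i ≠ y i
  symm := ⟨fun _ _ ⟨i, hi, hu⟩ => ⟨i, Ne.symm hi, fun j hj => hu j (Ne.symm hj)⟩⟩
  loopless := ⟨fun _ ⟨_, hi, _⟩ => hi rfl⟩

/-- The vertex `x` lies on a shortest `u,v`-path of `G`. (A walk whose length is the distance
between its ends is a path; if `u` and `v` are in different components, there is no walk.) -/
def OnShortestPath {V : Type*} (G : SimpleGraph V) (u v x : V) : Prop :=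
  ∃ p : G.Walk u v, p.length = G.dist u v ∧ x ∈ p.support

/-- `x` is a median of the triple `u, v, w`. -/
def IsMedian {V : Type*} (G : SimpleGraph V) (u v w x : V) : Prop :=
  OnShortestPath G u v x ∧ OnShortestPath G u w x ∧ OnShortestPath G v w x

/-- A median graph: every triple of (not necessarily distinct) vertices has a unique median.
In particular any two vertices are joined by a path. -/
def IsMedianGraph {V : Type*} (G : SimpleGraph V) : Prop :=
  ∀ u v w : V, ∃! x, IsMedian G u v w x

/-- `α_n(G)`: the number of induced subgraphs of `G` isomorphic to `Q_n`. An induced subgraph is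
given by its vertex set. -/
noncomputable def cubeCount {V : Type*} (G : SimpleGraph V) (n : ℕ) : ℕ :=
  {s : Set V | Nonempty (G.induce s ≃g hypercube n)}.ncard

/-- `m` is the maximum dimension of the hypercubes contained in `G` as induced subgraphs. -/
def IsMaxCubeDim {V : Type*} (G : SimpleGraph V) (m : ℕ) : Prop :=
  IsGreatest {n : ℕ | (hypercube n).IsIndContained G} m

/-! Fix a root `r` and grade the vertices by distance from `r`; adjacent vertices lie on different
levels. Let d(v) be the number of neighbours of v one level down. Any n of these span a unique
descending n-cube with top v (`exists_isDownCube`, `IsDownCube.unique`), and every induced n-cube is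
descending from its highest vertex (`exists_isDownCube_of_embedding`). Hence α_n is the sum over v
of C(d(v), n) (`cubeCount_eq`), and the largest d(v) is m.

If m ≤ 2i + 1, then C(d, i+1) ≤ C(d, i) for all d ≤ m, so the sums compare term by term. Strictness
needs a vertex with d = i. One exists because d drops by at most one on each step down
(`card_lowerNeighbors_le`), so a descent from a vertex with d = m cannot skip i. -/

namespace IsMedianGraph

variable {V : Type*} {G : SimpleGraph V}

/-! ### Distances, medians and bipartiteness -/

theorem connected (hG : IsMedianGraph G) (u v : V) : G.Reachable u v := by
  obtain ⟨x, ⟨⟨p, -⟩, -⟩, -⟩ := hG u v v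
  exact p.reachable

theorem dist_triangle (hG : IsMedianGraph G) (u v w : V) :
    G.dist u w ≤ G.dist u v + G.dist v w := by
  obtain ⟨p, hp⟩ := (hG.connected u v).exists_walk_length_eq_dist
  obtain ⟨q, hq⟩ := (hG.connected v w).exists_walk_length_eq_dist
  rw [← hp, ← hq, ← SimpleGraph.Walk.length_append]
  exact SimpleGraph.dist_le _

theorem onShortestPath_iff (hG : IsMedianGraph G) {u v x : V} :
    OnShortestPath G u v x ↔ G.dist u x + G.dist x v = G.dist u v := by
  classical
  constructor
  · rintro ⟨p, hp, hx⟩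
    have h := congrArg SimpleGraph.Walk.length (p.take_spec hx)
    rw [SimpleGraph.Walk.length_append] at h
    have h1 := SimpleGraph.dist_le (p.takeUntil x hx)
    have h2 := SimpleGraph.dist_le (p.dropUntil x hx)
    have h3 := hG.dist_triangle u x v
    omega
  · intro h
    obtain ⟨p, hp⟩ := (hG.connected u x).exists_walk_length_eq_dist
    obtain ⟨q, hq⟩ := (hG.connected x v).exists_walk_length_eq_dist
    refine ⟨p.append q, ?_, ?_⟩
    · rw [SimpleGraph.Walk.length_append]; omega
    · rw [SimpleGraph.Walk.mem_support_append_iff]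
      exact Or.inl p.end_mem_support

theorem exists_median (hG : IsMedianGraph G) (u v w : V) :
    ∃ x, G.dist u x + G.dist x v = G.dist u v ∧ G.dist u x + G.dist x w = G.dist u w ∧
      G.dist v x + G.dist x w = G.dist v w := by
  obtain ⟨x, ⟨h1, h2, h3⟩, -⟩ := hG u v w
  exact ⟨x, hG.onShortestPath_iff.1 h1, hG.onShortestPath_iff.1 h2, hG.onShortestPath_iff.1 h3⟩

theorem median_unique (hG : IsMedianGraph G) {u v w x y : V}
    (hx1 : G.dist u x + G.dist x v = G.dist u v) (hx2 : G.dist u x + G.dist x w = G.dist u w)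
    (hx3 : G.dist v x + G.dist x w = G.dist v w)
    (hy1 : G.dist u y + G.dist y v = G.dist u v) (hy2 : G.dist u y + G.dist y w = G.dist u w)
    (hy3 : G.dist v y + G.dist y w = G.dist v w) : x = y :=
  (hG u v w).unique
    ⟨hG.onShortestPath_iff.2 hx1, hG.onShortestPath_iff.2 hx2, hG.onShortestPath_iff.2 hx3⟩
    ⟨hG.onShortestPath_iff.2 hy1, hG.onShortestPath_iff.2 hy2, hG.onShortestPath_iff.2 hy3⟩

theorem dist_eq_zero (hG : IsMedianGraph G) {a b : V} : G.dist a b = 0 ↔ a = b :=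
  (hG.connected a b).dist_eq_zero_iff

theorem dist_adj {a b : V} (h : G.Adj a b) : G.dist a b = 1 :=
  SimpleGraph.dist_eq_one_iff_adj.2 h

/-- A median graph is bipartite: the levels of adjacent vertices differ. -/
theorem dist_of_adj (hG : IsMedianGraph G) (r : V) {a b : V} (h : G.Adj a b) :
    G.dist r a = G.dist r b + 1 ∨ G.dist r b = G.dist r a + 1 := by
  obtain ⟨x, h1, h2, h3⟩ := hG.exists_median r a b
  have hab := dist_adj h
  have hba := dist_adj h.symm
  rw [hab] at h3
  rcases Nat.eq_zero_or_pos (G.dist a x) with h0 | h0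
  · obtain rfl := hG.dist_eq_zero.1 h0
    omega
  · obtain rfl := hG.dist_eq_zero.1 (show G.dist x b = 0 by omega)
    omega

theorem dist_eq_two (hG : IsMedianGraph G) {a b c : V} (ha : G.Adj c a) (hb : G.Adj c b)
    (hab : a ≠ b) : G.dist a b = 2 := by
  have h1 := hG.dist_triangle a c b
  have h2 := dist_adj ha
  have h3 := dist_adj ha.symm
  have h4 := dist_adj hb
  have h5 : G.dist a b ≠ 0 := fun h => hab (hG.dist_eq_zero.1 h)
  have h6 : G.dist a b ≠ 1 := fun h => by
    have := hG.dist_of_adj c (SimpleGraph.dist_eq_one_iff_adj.1 h)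
    omega
  omega

/-- A median graph contains no `K_{2,3}`. -/
theorem eq_of_three_common (hG : IsMedianGraph G) {a b c x y : V} (hab : a ≠ b) (hac : a ≠ c)
    (hbc : b ≠ c) (xa : G.Adj x a) (xb : G.Adj x b) (xc : G.Adj x c) (ya : G.Adj y a)
    (yb : G.Adj y b) (yc : G.Adj y c) : x = y := by
  have h1 := hG.dist_eq_two xa xb hab
  have h2 := hG.dist_eq_two xa xc hac
  have h3 := hG.dist_eq_two xb xc hbc
  apply hG.median_unique (u := a) (v := b) (w := c) <;>
    simp only [h1, h2, h3, dist_adj xa.symm, dist_adj xb, dist_adj xc, dist_adj ya.symm,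
      dist_adj yb, dist_adj yc, dist_adj xb.symm, dist_adj yb.symm]

end IsMedianGraph

/-! ### Squares and cubes seen from a root -/

/-- `b` is a neighbour of `a` that is closer to the root `r`. -/
def IsBelow {V : Type*} (G : SimpleGraph V) (r a b : V) : Prop :=
  G.Adj a b ∧ G.dist r a = G.dist r b + 1

namespace IsMedianGraph

variable {V : Type*} {G : SimpleGraph V}

/-- Any common lower neighbour of two distinct vertices is a median of these vertices and the root.
-/
theorem below_unique (hG : IsMedianGraph G) {r a b x y : V} (hab : a ≠ b)
    (ax : IsBelow G r a x) (bx : IsBelow G r b x) (ay : IsBelow G r a y) (bz : IsBelow G r b y) :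
    x = y := by
  have h1 := hG.dist_eq_two ax.1.symm bx.1.symm hab
  have h2 := dist_adj ax.1
  have h3 := dist_adj ax.1.symm
  have h4 := dist_adj bx.1.symm
  have h5 := dist_adj ay.1
  have h6 := dist_adj ay.1.symm
  have h7 := dist_adj bz.1.symm
  have h8 := ax.2
  have h9 := bx.2
  have h10 := ay.2
  have h11 := bz.2
  apply hG.median_unique (u := r) (v := a) (w := b) <;> omega

/-- The median of `r`, `a`, `b` works: `a` and `b` are on one level at distance 2, so it is adjacent
to both. -/
theorem exists_below (hG : IsMedianGraph G) {r a b c : V} (hab : a ≠ b)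
    (ca : IsBelow G r c a) (cb : IsBelow G r c b) : ∃ x, IsBelow G r a x ∧ IsBelow G r b x := by
  have h1 := hG.dist_eq_two ca.1 cb.1 hab
  obtain ⟨x, hx1, hx2, hx3⟩ := hG.exists_median r a b
  have h2 := ca.2
  have h3 := cb.2
  rw [SimpleGraph.dist_comm (u := a) (v := x)] at hx3
  have h4 : G.dist x a = 1 := by omega
  have h5 : G.dist x b = 1 := by omega
  exact ⟨x, ⟨(SimpleGraph.dist_eq_one_iff_adj.1 h4).symm, by omega⟩,
    ⟨(SimpleGraph.dist_eq_one_iff_adj.1 h5).symm, by omega⟩⟩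

/-- Seven vertices of a cube, all but the lowest one, close up to a cube. -/
theorem below_of_cube (hG : IsMedianGraph G) {r p a b e c a' b' c' : V}
    (hab : a ≠ b) (hae : a ≠ e) (hbe : b ≠ e)
    (pa : IsBelow G r p a) (pb : IsBelow G r p b) (pe : IsBelow G r p e)
    (ac : IsBelow G r a c) (bc : IsBelow G r b c)
    (aa : IsBelow G r a a') (ea : IsBelow G r e a')
    (bb : IsBelow G r b b') (eb : IsBelow G r e b')
    (ac' : IsBelow G r a' c') (bc' : IsBelow G r b' c') : IsBelow G r c c' := by
  have l1 := pa.2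
  have l2 := ac.2
  have l3 := ac'.2
  have l4 := aa.2
  have l5 := bb.2
  have l6 := pb.2
  have hca : c ≠ a' := by
    rintro rfl
    obtain rfl := hG.eq_of_three_common hab hae hbe pa.1 pb.1 pe.1 ac.1.symm bc.1.symm ea.1.symm
    omega
  have hcb : c ≠ b' := by
    rintro rfl
    obtain rfl := hG.eq_of_three_common hab hae hbe pa.1 pb.1 pe.1 ac.1.symm bc.1.symm eb.1.symm
    omega
  have hab' : a' ≠ b' := by
    rintro rfl
    obtain rfl := hG.eq_of_three_common hab hae hbe pa.1 pb.1 pe.1 aa.1.symm bb.1.symm ea.1.symm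
    omega
  have d1 := hG.dist_eq_two ac.1 aa.1 hca
  have d2 := hG.dist_eq_two bc.1 bb.1 hcb
  have d3 := hG.dist_eq_two ea.1 eb.1 hab'
  obtain ⟨x, h1, h2, h3⟩ := hG.exists_median c a' b'
  rw [SimpleGraph.dist_comm (u := a')] at h3
  have xc : G.Adj c x := SimpleGraph.dist_eq_one_iff_adj.1 (by omega)
  have xa : G.Adj x a' := SimpleGraph.dist_eq_one_iff_adj.1 (by omega)
  have xb : G.Adj x b' := SimpleGraph.dist_eq_one_iff_adj.1 (by omega)
  -- The median `x` is adjacent to `c`, `a'`, `b'`. Below them it must be `c'`. Above them,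
  -- excluding `K_{2,3}` forces both `x = a` and `x = b`.
  rcases hG.dist_of_adj r xc with h | h
  · have := hG.below_unique hab' ⟨xa.symm, by omega⟩ ⟨xb.symm, by omega⟩ ac' bc'
    subst this
    exact ⟨xc, h⟩
  · obtain ⟨y, cy, ay⟩ := hG.exists_below hca ac aa
    obtain ⟨z, cz, bz⟩ := hG.exists_below hcb bc bb
    have hy := cy.2
    have hz := cz.2
    have hxa : x = a := by
      by_contra hne
      have hya : y ≠ a := by rintro rfl; omega
      have hyx : y ≠ x := by rintro rfl; omega
      exact hca (hG.eq_of_three_common hne hyx.symm hya.symm xc ac.1.symm cy.1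
        xa.symm aa.1.symm ay.1)
    have hxb : x = b := by
      by_contra hne
      have hzb : z ≠ b := by rintro rfl; omega
      have hzx : z ≠ x := by rintro rfl; omega
      exact hcb (hG.eq_of_three_common hne hzx.symm hzb.symm xc bc.1.symm cz.1
        xb.symm bb.1.symm bz.1)
    exact absurd (hxa.symm.trans hxb) hab

/-- Opposite edges of a 4-cycle point in the same direction. -/
theorem dist_square (hG : IsMedianGraph G) (r : V) {a b c d : V} (ab : G.Adj a b)
    (bc : G.Adj b c) (cd : G.Adj c d) (da : G.Adj d a) (hac : a ≠ c) (hbd : b ≠ d) :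
    G.dist r a + G.dist r c = G.dist r b + G.dist r d := by
  rcases hG.dist_of_adj r ab with h1 | h1 <;> rcases hG.dist_of_adj r bc with h2 | h2 <;>
    rcases hG.dist_of_adj r cd with h3 | h3 <;> rcases hG.dist_of_adj r da with h4 | h4 <;>
    -- Arithmetic on levels leaves only the case of one diagonal lying wholly above the other, which
    -- `below_unique` excludes.
    first
    | omega
    | exact absurd (hG.below_unique hac ⟨ab, by omega⟩ ⟨bc.symm, by omega⟩ ⟨da.symm, by omega⟩
        ⟨cd, by omega⟩) hbd
    | exact absurd (hG.below_unique hbd ⟨ab.symm, by omega⟩ ⟨da, by omega⟩ ⟨bc, by omega⟩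
        ⟨cd.symm, by omega⟩) hac

/-- The neighbours below `v` other than `u` map injectively to the neighbours below `u`. -/
theorem exists_meet_map (hG : IsMedianGraph G) {ι : Type*} {r v u : V} (hu : IsBelow G r v u)
    {S : Set ι} {g : ι → V} (hg : ∀ i ∈ S, IsBelow G r v (g i)) (hinj : Set.InjOn g S)
    (hne : ∀ i ∈ S, g i ≠ u) :
    ∃ z : ι → V, Set.InjOn z S ∧ ∀ i ∈ S, IsBelow G r u (z i) ∧ IsBelow G r (g i) (z i) := by
  have h : ∀ i, ∃ x, i ∈ S → IsBelow G r u x ∧ IsBelow G r (g i) x := by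
    intro i
    by_cases hi : i ∈ S
    · obtain ⟨x, hx⟩ := hG.exists_below (hne i hi).symm hu (hg i hi)
      exact ⟨x, fun _ => hx⟩
    -- Junk value outside `S`.
    · exact ⟨r, fun h => absurd h hi⟩
  choose z hz using h
  refine ⟨z, fun i hi j hj hij => ?_, hz⟩
  by_contra hne'
  have h1 := hz i hi
  have h2 := hz j hj
  rw [← hij] at h2
  have := hG.eq_of_three_common (hne i hi).symm (hne j hj).symm
    (fun h => hne' (hinj hi hj h)) hu.1 (hg i hi).1 (hg j hj).1 h1.1.1.symm h1.2.1.symm h2.2.1.symm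
  have h3 := hu.2
  have h4 := h1.1.2
  rw [this] at h3
  omega

end IsMedianGraph

/-! ### Descending cubes -/

/-- `F` describes a cube with highest vertex `v` whose neighbours of `v` are the `g i`, `i ∈ S`;
the vertex `F T` is reached from `v` by descending in the directions `i ∈ T`. -/
structure IsDownCube {V ι : Type*} [DecidableEq ι] (G : SimpleGraph V) (r : V) (S : Finset ι)
    (g : ι → V) (v : V) (F : Finset ι → V) : Prop where
  top : F ∅ = v
  single : ∀ i ∈ S, F {i} = g i
  inj : Set.InjOn g S
  below : ∀ T ⊆ S, ∀ i ∈ S, i ∉ T → IsBelow G r (F T) (F (insert i T))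

namespace IsDownCube

variable {V ι : Type*} [DecidableEq ι] {G : SimpleGraph V} {r v : V} {S : Finset ι}
  {g : ι → V} {F : Finset ι → V}

theorem dist_add_card (hF : IsDownCube G r S g v F) {T : Finset ι} (hT : T ⊆ S) :
    G.dist r (F T) + T.card = G.dist r v := by
  induction T using Finset.induction_on with
  | empty => simp [hF.top]
  | insert i T hi ih =>
    rw [Finset.insert_subset_iff] at hT
    have := (hF.below T hT.2 i hT.1 hi).2
    rw [Finset.card_insert_of_notMem hi]
    have := ih hT.2
    omega

/-- If directions `i` and `j` collapsed after a further direction `k`, the collapsed vertex and `F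
T` would share three neighbours, distinct by induction: a `K_{2,3}`. -/
theorem insert_ne (hG : IsMedianGraph G) (hF : IsDownCube G r S g v F) {T : Finset ι}
    (hT : T ⊆ S) : ∀ i ∈ S, ∀ j ∈ S, i ∉ T → j ∉ T → i ≠ j →
      F (insert i T) ≠ F (insert j T) := by
  induction T using Finset.induction_on with
  | empty =>
    intro i hi j hj _ _ hij
    simp only [insert_empty_eq, hF.single i hi, hF.single j hj]
    exact fun h => hij (hF.inj hi hj h)
  | insert k T hk ih =>
    intro i hi j hj hiT hjT hij heq
    rw [Finset.insert_subset_iff] at hT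
    rw [Finset.mem_insert, not_or] at hiT hjT
    have hki : k ∉ insert i T := by simp [hk, Ne.symm hiT.1]
    have hkj : k ∉ insert j T := by simp [hk, Ne.symm hjT.1]
    have hik : i ∉ insert k T := by simp [hiT]
    have hiS : insert i T ⊆ S := Finset.insert_subset hi hT.2
    have hjS : insert j T ⊆ S := Finset.insert_subset hj hT.2
    have hkS : insert k T ⊆ S := Finset.insert_subset hT.1 hT.2
    have b1 := hF.below _ hiS k hT.1 hki
    have b2 := hF.below _ hjS k hT.1 hkj
    have b3 := hF.below _ hkS i hi hik
    rw [Finset.insert_comm] at b1 b2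
    rw [← heq] at b2
    have a1 := hF.below _ hT.2 i hi hiT.2
    have := hG.eq_of_three_common (ih hT.2 i hi j hj hiT.2 hjT.2 hij)
      (ih hT.2 i hi k hT.1 hiT.2 hk hiT.1) (ih hT.2 j hj k hT.1 hjT.2 hk hjT.1)
      a1.1 (hF.below _ hT.2 j hj hjT.2).1
      (hF.below _ hT.2 k hT.1 hk).1 b1.1.symm b2.1.symm b3.1.symm
    have h1 := a1.2
    have h2 := b1.2
    rw [← this] at h2
    omega

/-- Beyond the top and its neighbours, each vertex is a common lower neighbour of two distinct
earlier vertices, hence forced. -/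
theorem unique (hG : IsMedianGraph G) (hF : IsDownCube G r S g v F) {F' : Finset ι → V}
    (hF' : IsDownCube G r S g v F') (T : Finset ι) (hT : T ⊆ S) : F T = F' T := by
  induction T using Finset.strongInduction with
  | H T ih =>
  rcases T.eq_empty_or_nonempty with rfl | ⟨i, hi⟩
  · rw [hF.top, hF'.top]
  obtain ⟨T, hiT, rfl⟩ : ∃ T', i ∉ T' ∧ insert i T' = T :=
    ⟨T.erase i, Finset.notMem_erase i T, Finset.insert_erase hi⟩
  rw [Finset.insert_subset_iff] at hT
  rcases T.eq_empty_or_nonempty with rfl | ⟨j, hj⟩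
  · simp only [insert_empty_eq, hF.single i hT.1, hF'.single i hT.1]
  obtain ⟨T, hjT, rfl⟩ : ∃ T', j ∉ T' ∧ insert j T' = T :=
    ⟨T.erase j, Finset.notMem_erase j T, Finset.insert_erase hj⟩
  rw [Finset.insert_subset_iff] at hT
  rw [Finset.mem_insert, not_or] at hiT
  have hj' : j ∉ insert i T := by simp [hjT, Ne.symm hiT.1]
  have hi' : i ∉ insert j T := by simp [hiT]
  have hiS : insert i T ⊆ S := Finset.insert_subset hT.1 hT.2.2
  have hjS : insert j T ⊆ S := Finset.insert_subset hT.2.1 hT.2.2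
  have e1 := ih (insert i T) (by
    rw [Finset.insert_comm]; exact Finset.ssubset_insert hj') hiS
  have e2 := ih (insert j T) (Finset.ssubset_insert hi') hjS
  have b1 := hF.below _ hiS j hT.2.1 hj'
  have b2 := hF'.below _ hiS j hT.2.1 hj'
  rw [Finset.insert_comm] at b1 b2
  rw [← e1] at b2
  have b3 := hF'.below _ hjS i hT.1 hi'
  rw [← e2] at b3
  exact hG.below_unique (hF.insert_ne hG hT.2.2 i hT.1 j hT.2.1 hiT.2 hjT hiT.1)
    b1 (hF.below _ hjS i hT.1 hi') b2 b3

theorem dist_single_le (hG : IsMedianGraph G) (hF : IsDownCube G r S g v F) {i : ι} (hi : i ∈ S)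
    {T : Finset ι} (hT : T ⊆ S) (hiT : i ∉ T) : G.dist (g i) (F (insert i T)) ≤ T.card := by
  induction T using Finset.induction_on with
  | empty => simp [hF.single i hi]
  | insert j T hj ih =>
    rw [Finset.insert_subset_iff] at hT
    rw [Finset.mem_insert, not_or] at hiT
    have h1 := ih hT.2 hiT.2
    have h2 := hF.below (insert i T) (Finset.insert_subset hi hT.2) j hT.1
      (by simp [hj, Ne.symm hiT.1])
    rw [Finset.insert_comm] at h2
    have h3 := hG.dist_triangle (g i) (F (insert i T)) (F (insert i (insert j T)))
    rw [IsMedianGraph.dist_adj h2.1] at h3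
    rw [Finset.card_insert_of_notMem hj]
    omega

/-- Parallel edges of a cube point the same way as seen from any vertex, so `dist_square` with `g i`
as root carries the claim over from the edge between `v` and `g i`. -/
theorem dist_single_succ (hG : IsMedianGraph G) (hF : IsDownCube G r S g v F) {i : ι} (hi : i ∈ S)
    {T : Finset ι} (hT : T ⊆ S) (hiT : i ∉ T) :
    G.dist (g i) (F T) = G.dist (g i) (F (insert i T)) + 1 := by
  induction T using Finset.induction_on with
  | empty =>
    have h := (hF.below ∅ (by simp) i hi (by simp)).1
    rw [insert_empty_eq, hF.single i hi] at h
    simp [hF.single i hi, IsMedianGraph.dist_adj h.symm]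
  | insert j T hj ih =>
    rw [Finset.insert_subset_iff] at hT
    rw [Finset.mem_insert, not_or] at hiT
    have h1 := ih hT.2 hiT.2
    have a1 := hF.below T hT.2 i hi hiT.2
    have a2 := hF.below T hT.2 j hT.1 hj
    have a3 := hF.below (insert i T) (Finset.insert_subset hi hT.2) j hT.1
      (by simp [hj, Ne.symm hiT.1])
    have a4 := hF.below (insert j T) (Finset.insert_subset hT.1 hT.2) i hi (by simp [hiT])
    rw [Finset.insert_comm] at a3
    have hne : F T ≠ F (insert i (insert j T)) := fun h => by
      have h1 := a1.2
      have h2 := a3.2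
      rw [← h] at h2
      omega
    have := hG.dist_square (g i) a1.1 a3.1 a4.1.symm a2.1.symm hne
      (hF.insert_ne hG hT.2 i hi j hT.1 hiT.2 hj hiT.1)
    omega

/-- Measured from `g i`, the vertex `F T` is at distance at most `T.card - 1` and `F T'` at least
`T'.card + 1`. This lower bound on distances yields both injectivity of `F` and inducedness of the
cube. -/
theorem card_le_of_mem (hG : IsMedianGraph G) (hF : IsDownCube G r S g v F) {T T' : Finset ι}
    (hT : T ⊆ S) (hT' : T' ⊆ S) {i : ι} (hi : i ∈ T) (hi' : i ∉ T') :
    T'.card + 2 ≤ T.card + G.dist (F T) (F T') := by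
  have hiS := hT hi
  have h1 := hF.dist_single_le hG hiS ((Finset.erase_subset i T).trans hT) (Finset.notMem_erase i T)
  rw [Finset.insert_erase hi] at h1
  have h2 := Finset.card_erase_add_one hi
  have h3 := hF.dist_single_succ hG hiS hT' hi'
  have h4 := hF.dist_add_card (Finset.insert_subset hiS hT')
  have h5 := hF.dist_add_card (Finset.singleton_subset_iff.2 hiS)
  rw [hF.single i hiS, Finset.card_singleton] at h5
  rw [Finset.card_insert_of_notMem hi'] at h4
  have h6 := hG.dist_triangle r (F (insert i T')) (g i)
  rw [SimpleGraph.dist_comm (u := F (insert i T'))] at h6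
  have h7 := hG.dist_triangle (g i) (F T) (F T')
  omega

theorem subset_of_dist (hG : IsMedianGraph G) (hF : IsDownCube G r S g v F) {T T' : Finset ι}
    (hT : T ⊆ S) (hT' : T' ⊆ S) (h : T.card + G.dist (F T) (F T') ≤ T'.card + 1) : T ⊆ T' := by
  intro i hi
  by_contra hi'
  have := hF.card_le_of_mem hG hT hT' hi hi'
  omega

theorem injOn (hG : IsMedianGraph G) (hF : IsDownCube G r S g v F) {T T' : Finset ι}
    (hT : T ⊆ S) (hT' : T' ⊆ S) (h : F T = F T') : T = T' := by
  have h1 := hF.dist_add_card hT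
  have h2 := hF.dist_add_card hT'
  rw [← h] at h2
  exact (hF.subset_of_dist hG hT hT' (by rw [h, SimpleGraph.dist_self]; omega)).antisymm
    (hF.subset_of_dist hG hT' hT (by rw [h, SimpleGraph.dist_self]; omega))

theorem adj_iff (hG : IsMedianGraph G) (hF : IsDownCube G r S g v F) {T T' : Finset ι}
    (hT : T ⊆ S) (hT' : T' ⊆ S) :
    G.Adj (F T) (F T') ↔ (∃ i ∉ T, insert i T = T') ∨ ∃ i ∉ T', insert i T' = T := by
  constructor
  · intro h
    have h1 := hF.dist_add_card hT
    have h2 := hF.dist_add_card hT'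
    rcases hG.dist_of_adj r h with h3 | h3
    · left
      exact Finset.covBy_iff_exists_insert.1 <| Finset.covBy_iff_card_sdiff_eq_one.2 <| by
        have hs := hF.subset_of_dist hG hT hT' (by rw [IsMedianGraph.dist_adj h]; omega)
        refine ⟨hs, ?_⟩
        rw [Finset.card_sdiff_of_subset hs]
        omega
    · right
      exact Finset.covBy_iff_exists_insert.1 <| Finset.covBy_iff_card_sdiff_eq_one.2 <| by
        have hs := hF.subset_of_dist hG hT' hT (by rw [IsMedianGraph.dist_adj h.symm]; omega)
        refine ⟨hs, ?_⟩
        rw [Finset.card_sdiff_of_subset hs]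
        omega
  · rintro (⟨i, hi, rfl⟩ | ⟨i, hi, rfl⟩)
    · exact (hF.below T hT i (hT' (Finset.mem_insert_self i T)) hi).1
    · exact (hF.below T' hT' i (hT (Finset.mem_insert_self i T')) hi).1.symm

end IsDownCube

/-- Any set of neighbours below `v` spans a cube with highest vertex `v`. -/
theorem IsMedianGraph.exists_isDownCube {V ι : Type*} [DecidableEq ι] {G : SimpleGraph V}
    (hG : IsMedianGraph G) (r : V) (S : Finset ι) : ∀ (v : V) (g : ι → V), Set.InjOn g S →
      (∀ i ∈ S, IsBelow G r v (g i)) → ∃ F, IsDownCube G r S g v F := by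
  induction S using Finset.induction_on with
  | empty =>
    intro v g _ _
    exact ⟨fun _ => v, rfl, by simp, by simp, by simp⟩
  | insert u S hu ih =>
    intro v g hinj hg
    have huv := hg u (Finset.mem_insert_self u S)
    have hgS : ∀ i ∈ S, IsBelow G r v (g i) := fun i hi => hg i (Finset.mem_insert_of_mem hi)
    have hinjS : Set.InjOn g S := hinj.mono (by simp)
    have hne : ∀ i ∈ S, g i ≠ g u := fun i hi h => hu <| by
      rwa [← hinj (by simp [hi]) (by simp) h]
    -- The new cube is a prism: `A` hangs from `v`, its translate `B` from `g u`, and `key` supplies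
    -- the vertical edges.
    obtain ⟨z, hzinj, hz⟩ := hG.exists_meet_map huv (S := (S : Set ι)) hgS hinjS hne
    obtain ⟨A, hA⟩ := ih v g hinjS hgS
    obtain ⟨B, hB⟩ := ih (g u) z hzinj (fun i hi => (hz i hi).1)
    have key : ∀ T ⊆ S, IsBelow G r (A T) (B T) ∧
        ∀ i ∈ S, i ∉ T → A (insert i T) ≠ B T := by
      intro T
      induction T using Finset.strongInduction with
      | H T IH =>
      intro hT
      rcases T.eq_empty_or_nonempty with rfl | ⟨i, hi⟩
      · rw [hA.top, hB.top]
        refine ⟨huv, fun i hi _ => ?_⟩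
        rw [insert_empty_eq, hA.single i hi]
        exact hne i hi
      obtain ⟨T, hiT, rfl⟩ : ∃ T', i ∉ T' ∧ insert i T' = T :=
        ⟨T.erase i, Finset.notMem_erase i T, Finset.insert_erase hi⟩
      rw [Finset.insert_subset_iff] at hT
      have IT := IH T (Finset.ssubset_insert hiT) hT.2
      have ai := hA.below T hT.2 i hT.1 hiT
      have bi := hB.below T hT.2 i hT.1 hiT
      have main : IsBelow G r (A (insert i T)) (B (insert i T)) := by
        rcases T.eq_empty_or_nonempty with rfl | ⟨j, hj⟩
        · rw [insert_empty_eq, hA.single i hT.1, hB.single i hT.1]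
          exact (hz i hT.1).2
        obtain ⟨T, hjT, rfl⟩ : ∃ T', j ∉ T' ∧ insert j T' = T :=
          ⟨T.erase j, Finset.notMem_erase j T, Finset.insert_erase hj⟩
        rw [Finset.insert_subset_iff] at hT
        rw [Finset.mem_insert, not_or] at hiT
        have hj' : j ∉ insert i T := by simp [hjT, Ne.symm hiT.1]
        have hiS : insert i T ⊆ S := Finset.insert_subset hT.1 hT.2.2
        have hjS : insert j T ⊆ S := Finset.insert_subset hT.2.1 hT.2.2
        have I0 := IH T ((Finset.ssubset_insert hjT).trans_subset (Finset.subset_insert _ _))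
          hT.2.2
        have I1 := IH (insert i T) (by
          rw [Finset.insert_comm]; exact Finset.ssubset_insert hj') hiS
        have aj := hA.below _ hiS j hT.2.1 hj'
        have bj := hB.below _ hiS j hT.2.1 hj'
        rw [Finset.insert_comm] at aj bj
        -- With two directions `i`, `j` present, the edge closes the 3-cube in directions `i`, `j`,
        -- `u` below `A T`.
        exact hG.below_of_cube (hA.insert_ne hG hT.2.2 i hT.1 j hT.2.1 hiT.2 hjT hiT.1)
          (I0.2 i hT.1 hiT.2) (I0.2 j hT.2.1 hjT)
          (hA.below T hT.2.2 i hT.1 hiT.2) (hA.below T hT.2.2 j hT.2.1 hjT) I0.1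
          aj ai I1.1 (hB.below T hT.2.2 i hT.1 hiT.2) IT.1 (hB.below T hT.2.2 j hT.2.1 hjT)
          bj bi
      refine ⟨main, fun j hj hjT heq => ?_⟩
      rw [Finset.mem_insert, not_or] at hjT
      have hi' : i ∉ insert j T := by simp [hiT, Ne.symm hjT.1]
      have aj := hA.below T hT.2 j hj hjT.2
      have c1 := hA.below _ (Finset.insert_subset hj hT.2) i hT.1 hi'
      rw [Finset.insert_comm, heq] at c1
      have := hG.eq_of_three_common (hA.insert_ne hG hT.2 j hj i hT.1 hjT.2 hiT hjT.1)
        (IT.2 j hj hjT.2) (IT.2 i hT.1 hiT) aj.1 ai.1 IT.1.1 c1.1.symm main.1.symm bi.1.symm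
      have h1 := ai.2
      have h2 := main.2
      rw [← this] at h2
      omega
    refine ⟨fun T => if u ∈ T then B (T.erase u) else A T, ?_, ?_, hinj, ?_⟩
    · simp [hA.top]
    · intro i hi
      rcases Finset.mem_insert.1 hi with rfl | hi
      · simp [hB.top]
      · have : u ≠ i := fun h => hu (h ▸ hi)
        simp [this, hA.single i hi]
    · intro T hT i hi hiT
      rcases Finset.mem_insert.1 hi with rfl | hi
      · simp only [hiT, if_false, Finset.mem_insert_self, if_true, Finset.erase_insert hiT]
        exact (key T ((Finset.subset_insert_iff_of_notMem hiT).1 hT)).1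
      · have hui : u ≠ i := fun h => hu (h ▸ hi)
        by_cases huT : u ∈ T
        · simp only [huT, if_true, Finset.mem_insert, or_true]
          rw [Finset.erase_insert_of_ne hui.symm]
          exact hB.below _ (Finset.subset_insert_iff.1 hT) i hi (by simp [hiT])
        · simp only [huT, if_false, Finset.mem_insert, hui, or_self]
          exact hA.below _ ((Finset.subset_insert_iff_of_notMem huT).1 hT) i hi hiT

/-! ### Induced hypercubes as descending cubes -/

/-- The set of positions of the ones of a binary string. -/
def onesFinset {n : ℕ} (x : Fin n → Bool) : Finset (Fin n) := Finset.univ.filter fun i => x i = true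

theorem mem_onesFinset {n : ℕ} {x : Fin n → Bool} {i : Fin n} : i ∈ onesFinset x ↔ x i = true := by
  simp [onesFinset]

theorem onesFinset_bijective (n : ℕ) : Function.Bijective (onesFinset (n := n)) := by
  constructor
  · intro x y h
    ext i
    have := Finset.ext_iff.1 h i
    simp only [mem_onesFinset] at this
    exact Bool.eq_iff_iff.2 this
  · intro T
    exact ⟨fun i => decide (i ∈ T), by ext i; simp [mem_onesFinset]⟩

theorem hypercube_adj_iff {n : ℕ} {x y : Fin n → Bool} :
    (hypercube n).Adj x y ↔ (∃ i ∉ onesFinset x, insert i (onesFinset x) = onesFinset y) ∨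
      ∃ i ∉ onesFinset y, insert i (onesFinset y) = onesFinset x := by
  have aux : ∀ (x y : Fin n → Bool) (i : Fin n), (∀ j, x j ≠ y j → j = i) → x i = false →
      y i = true → i ∉ onesFinset x ∧ insert i (onesFinset x) = onesFinset y := by
    intro x y i hu hx hy
    refine ⟨by simp [mem_onesFinset, hx], ?_⟩
    ext j
    rw [Finset.mem_insert, mem_onesFinset, mem_onesFinset]
    by_cases hj : j = i
    · simp [hj, hy]
    · have : x j = y j := by
        by_contra h
        exact hj (hu j h)
      simp [hj, this]
  have aux' : ∀ (x y : Fin n → Bool) (i : Fin n), i ∉ onesFinset x →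
      insert i (onesFinset x) = onesFinset y → x i ≠ y i ∧ ∀ j, x j ≠ y j → j = i := by
    intro x y i hi h
    have h' : ∀ j, (j = i ∨ x j = true) ↔ y j = true := fun j => by
      have := Finset.ext_iff.1 h j
      rwa [Finset.mem_insert, mem_onesFinset, mem_onesFinset] at this
    rw [mem_onesFinset] at hi
    refine ⟨fun hxy => hi (hxy.trans ((h' i).1 (Or.inl rfl))), fun j hj => ?_⟩
    by_contra hji
    exact hj (Bool.eq_iff_iff.2 (by simpa [hji] using h' j))
  constructor
  · rintro ⟨i, hi, hu⟩
    cases hx : x i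
    · exact Or.inl ⟨i, aux x y i hu hx (by simpa [hx] using hi.symm)⟩
    · exact Or.inr ⟨i, aux y x i (fun j hj => hu j hj.symm) (by simpa [hx] using hi.symm) hx⟩
  · rintro (⟨i, hi, h⟩ | ⟨i, hi, h⟩)
    · exact ⟨i, aux' x y i hi h⟩
    · obtain ⟨h1, h2⟩ := aux' y x i hi h
      exact ⟨i, h1.symm, fun j hj => h2 j hj.symm⟩

theorem nonempty_induce_iso_iff {V W : Type*} {G : SimpleGraph V} {H : SimpleGraph W} {s : Set V} :
    Nonempty (G.induce s ≃g H) ↔ ∃ φ : H ↪g G, Set.range φ = s := by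
  constructor
  · rintro ⟨e⟩
    refine ⟨(SimpleGraph.Embedding.induce s).comp e.symm.toEmbedding, ?_⟩
    ext x
    constructor
    · rintro ⟨y, rfl⟩
      exact (e.symm y).2
    · intro hx
      exact ⟨e ⟨x, hx⟩, by simp⟩
  · rintro ⟨φ, rfl⟩
    exact ⟨SimpleGraph.Iso.symm ⟨Equiv.ofInjective φ φ.injective, by simp⟩⟩

theorem IsDownCube.exists_embedding {V : Type*} {G : SimpleGraph V} (hG : IsMedianGraph G)
    {r v : V} {n : ℕ} {g : Fin n → V} {F : Finset (Fin n) → V}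
    (hF : IsDownCube G r Finset.univ g v F) : ∃ φ : hypercube n ↪g G, Set.range φ = Set.range F := by
  refine ⟨⟨⟨fun x => F (onesFinset x), fun x y h => ?_⟩, ?_⟩, ?_⟩
  · exact (onesFinset_bijective n).1 (hF.injOn hG (Finset.subset_univ _) (Finset.subset_univ _) h)
  · intro x y
    rw [hypercube_adj_iff]
    exact hF.adj_iff hG (Finset.subset_univ _) (Finset.subset_univ _)
  · exact (onesFinset_bijective n).2.range_comp F

/-- Every induced cube of a median graph, read from its highest vertex, is a descending cube. -/
theorem IsMedianGraph.exists_isDownCube_of_embedding {V : Type*} {G : SimpleGraph V}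
    (hG : IsMedianGraph G) (r : V) {n : ℕ} (φ : hypercube n ↪g G) :
    ∃ (v : V) (g : Fin n → V) (F : Finset (Fin n) → V),
      IsDownCube G r Finset.univ g v F ∧ Set.range F = Set.range φ := by
  obtain ⟨t, ht⟩ := Finite.exists_max fun x => G.dist r (φ x)
  -- Coordinates relative to the highest vertex `t`: `y T` flips `t` in the positions of `T`.
  set y : Finset (Fin n) → Fin n → Bool := fun T i => xor (t i) (decide (i ∈ T)) with hy
  have hyinj : Function.Injective y := by
    intro T T' h
    ext i
    have := congrFun h i
    simpa [hy] using this
  have hadj : ∀ T, ∀ i ∉ T, G.Adj (φ (y T)) (φ (y (insert i T))) := by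
    intro T i hi
    rw [φ.map_adj_iff]
    refine ⟨i, by simp [hy, hi], fun j hj => ?_⟩
    by_contra hji
    exact hj (by simp [hy, hji])
  -- Edges at `t` descend by maximality; parallel edges inherit this through `dist_square`.
  have hbelow : ∀ T, ∀ i ∉ T, IsBelow G r (φ (y T)) (φ (y (insert i T))) := by
    intro T
    induction T using Finset.induction_on with
    | empty =>
      intro i hi
      have hye : y ∅ = t := by ext i; simp [hy]
      have h := hadj ∅ i hi
      refine ⟨h, ?_⟩
      have h1 := ht (y (insert i ∅))
      rw [hye] at h ⊢
      rcases hG.dist_of_adj r h with h2 | h2 <;> omega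
    | insert j T hj ih =>
      intro i hi
      have h := hadj _ i hi
      refine ⟨h, ?_⟩
      rw [Finset.mem_insert, not_or] at hi
      have h1 := (ih i hi.2).2
      have hji : j ∉ insert i T := by simp [hj, Ne.symm hi.1]
      have h2 := hadj _ j hji
      rw [Finset.insert_comm] at h2
      have h3 := hG.dist_square r (hadj T i hi.2) h2 h.symm (hadj T j hj).symm
        (fun e => by
          have := hyinj (φ.injective e)
          exact hi.2 (this ▸ Finset.mem_insert_self i _))
        (fun e => by
          have := hyinj (φ.injective e)
          exact hji (this ▸ Finset.mem_insert_self j _))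
      omega
  refine ⟨φ (y ∅), fun i => φ (y {i}), fun T => φ (y T), ⟨rfl, fun _ _ => rfl, ?_, ?_⟩, ?_⟩
  · intro i _ j _ h
    exact Finset.singleton_injective (hyinj (φ.injective h))
  · exact fun T _ i _ hi => hbelow T i hi
  · have hsurj : Function.Surjective y := fun x =>
      ⟨(Finset.univ : Finset (Fin n)).filter fun i => xor (t i) (x i) = true, by
        ext i; cases h : t i <;> cases h' : x i <;> simp [hy, h, h']⟩
    exact hsurj.range_comp φ

namespace IsDownCube

variable {V : Type*} {G : SimpleGraph V} {r v v' : V} {n : ℕ} {g g' : Fin n → V}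
  {F F' : Finset (Fin n) → V}

/-- Recovers the chosen lower neighbours from the vertex set and the top, for injectivity in the
count. -/
theorem range_singletons (hF : IsDownCube G r Finset.univ g v F) :
    Set.range g = {x ∈ Set.range F | G.dist r x + 1 = G.dist r v} := by
  ext x
  constructor
  · rintro ⟨i, rfl⟩
    have h := hF.dist_add_card (Finset.subset_univ {i})
    rw [Finset.card_singleton, hF.single i (Finset.mem_univ i)] at h
    exact ⟨⟨{i}, hF.single i (Finset.mem_univ i)⟩, h⟩
  · rintro ⟨⟨T, rfl⟩, h⟩
    have h' := hF.dist_add_card (Finset.subset_univ T)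
    obtain ⟨i, rfl⟩ := Finset.card_eq_one.1 (show T.card = 1 by omega)
    exact ⟨i, (hF.single i (Finset.mem_univ i)).symm⟩

theorem top_eq_of_range_eq (hF : IsDownCube G r Finset.univ g v F)
    (hF' : IsDownCube G r Finset.univ g' v' F') (h : Set.range F = Set.range F') : v = v' := by
  obtain ⟨T, hT⟩ : v' ∈ Set.range F := h ▸ ⟨∅, hF'.top⟩
  obtain ⟨T', hT'⟩ : v ∈ Set.range F' := h ▸ ⟨∅, hF.top⟩
  have h1 := hF.dist_add_card (Finset.subset_univ T)
  have h2 := hF'.dist_add_card (Finset.subset_univ T')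
  rw [hT] at h1
  rw [hT'] at h2
  have h3 : T = ∅ := Finset.card_eq_zero.1 (by omega)
  rw [← hT, h3, hF.top]

/-- Two labellings of the same lower neighbours differ by a permutation `σ` of the directions;
relabelling reduces this to `unique`. -/
theorem range_eq_of_range_eq (hG : IsMedianGraph G) (hF : IsDownCube G r Finset.univ g v F)
    (hF' : IsDownCube G r Finset.univ g' v F') (h : Set.range g = Set.range g') :
    Set.range F = Set.range F' := by
  have hg : Function.Injective g := fun i j e => hF.inj (by simp) (by simp) e
  have hg' : Function.Injective g' := fun i j e => hF'.inj (by simp) (by simp) e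
  let σ : Fin n ≃ Fin n :=
    (Equiv.ofInjective g' hg').trans ((Equiv.setCongr h.symm).trans (Equiv.ofInjective g hg).symm)
  have hσ : ∀ i, g (σ i) = g' i := fun i => by
    simp only [σ, Equiv.trans_apply]
    rw [Equiv.apply_ofInjective_symm hg]
    rfl
  have hcube : IsDownCube G r Finset.univ g' v fun T => F (T.map σ.toEmbedding) := by
    refine ⟨by simp [hF.top], fun i _ => ?_, hF'.inj, fun T _ i _ hi => ?_⟩
    · simp [hF.single, hσ]
    · rw [Finset.map_insert]
      exact hF.below _ (Finset.subset_univ _) _ (Finset.mem_univ _) (by simpa using hi)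
  have heq : F' = fun T => F (T.map σ.toEmbedding) :=
    funext fun T => hF'.unique hG hcube T (Finset.subset_univ T)
  have hs : Function.Surjective fun T : Finset (Fin n) => T.map σ.toEmbedding := fun T =>
    ⟨T.map σ.symm.toEmbedding, by ext; simp⟩
  rw [heq]
  exact (hs.range_comp F).symm

end IsDownCube

/-! ### Counting cubes by their tops -/

section Count

open Classical in
/-- The neighbours of `v` that are closer to the root `r`. -/
noncomputable def lowerNeighbors {V : Type*} [Fintype V] (G : SimpleGraph V) (r v : V) : Finset V :=
  Finset.univ.filter fun x => IsBelow G r v x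

theorem mem_lowerNeighbors {V : Type*} [Fintype V] {G : SimpleGraph V} {r v x : V} :
    x ∈ lowerNeighbors G r v ↔ IsBelow G r v x := by
  simp [lowerNeighbors]

variable {V : Type*} [Fintype V] {G : SimpleGraph V}

/-- Every cube is determined by its highest vertex `v` and a set of lower neighbours of `v`. -/
theorem IsMedianGraph.cubeCount_eq (hG : IsMedianGraph G) (r : V) (n : ℕ) :
    cubeCount G n = ∑ v, (lowerNeighbors G r v).card.choose n := by
  classical
  -- Pairs of a top and an `n`-set of its lower neighbours, to be matched with the cubes.
  set P : Finset (Σ _ : V, Finset V) :=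
    Finset.univ.sigma fun v => (lowerNeighbors G r v).powersetCard n with hP
  have hcard : P.card = ∑ v, (lowerNeighbors G r v).card.choose n := by
    simp [hP, Finset.card_sigma, Finset.card_powersetCard]
  rw [← hcard, ← Set.ncard_coe_finset, cubeCount]
  have hex : ∀ p : Σ _ : V, Finset V, p ∈ P → ∃ g F, IsDownCube G r Finset.univ g p.1 F ∧
      Set.range (g : Fin n → V) = p.2 := by
    rintro ⟨v, S⟩ hp
    rw [hP, Finset.mem_sigma, Finset.mem_powersetCard] at hp
    obtain ⟨-, hS, hc⟩ := hp
    let e := S.equivFinOfCardEq hc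
    obtain ⟨F, hF⟩ := hG.exists_isDownCube r Finset.univ v (fun i => (e.symm i : V))
      (fun i _ j _ h => e.symm.injective (Subtype.ext h))
      (fun i _ => mem_lowerNeighbors.1 (hS (e.symm i).2))
    refine ⟨_, F, hF, ?_⟩
    ext x
    constructor
    · rintro ⟨i, rfl⟩
      exact (e.symm i).2
    · intro hx
      exact ⟨e ⟨x, hx⟩, by simp⟩
  choose g F hF hg using hex
  symm
  refine Set.ncard_congr (fun p hp => Set.range (F p hp)) (fun p hp => ?_)
    (fun p q hp hq h => ?_) (fun s hs => ?_)
  · exact nonempty_induce_iso_iff.2 ((hF p hp).exists_embedding hG)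
  · have h1 := (hF p hp).top_eq_of_range_eq (hF q hq) h
    have h2 := (hF p hp).range_singletons
    rw [h, h1, ← (hF q hq).range_singletons, hg p hp, hg q hq] at h2
    exact Sigma.ext h1 (heq_of_eq (Finset.coe_injective h2))
  · obtain ⟨φ, rfl⟩ := nonempty_induce_iso_iff.1 hs
    obtain ⟨v, g', F', hF', hr⟩ := IsMedianGraph.exists_isDownCube_of_embedding hG r φ
    have hp : (⟨v, Finset.univ.image g'⟩ : Σ _ : V, Finset V) ∈ P := by
      rw [hP, Finset.mem_sigma, Finset.mem_powersetCard]
      refine ⟨Finset.mem_univ _, fun x hx => ?_, ?_⟩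
      · obtain ⟨i, -, rfl⟩ := Finset.mem_image.1 hx
        rw [mem_lowerNeighbors]
        have := hF'.below ∅ (by simp) i (by simp) (by simp)
        rwa [hF'.top, insert_empty_eq, hF'.single i (by simp)] at this
      · rw [Finset.card_image_of_injOn hF'.inj, Finset.card_univ, Fintype.card_fin]
    refine ⟨_, hp, ?_⟩
    rw [← hr]
    exact (hF _ hp).range_eq_of_range_eq hG hF' (by rw [hg _ hp]; simp)

/-- The lower neighbours of `v` other than `u` inject into those of `u` by taking meets; the `+ 1`
counts `u` itself. -/
theorem IsMedianGraph.card_lowerNeighbors_le (hG : IsMedianGraph G) {r v u : V}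
    (hu : IsBelow G r v u) :
    (lowerNeighbors G r v).card ≤ (lowerNeighbors G r u).card + 1 := by
  classical
  have hS : ∀ x ∈ (lowerNeighbors G r v).erase u, IsBelow G r v x := fun x hx =>
    mem_lowerNeighbors.1 (Finset.mem_of_mem_erase hx)
  obtain ⟨z, hz, hzb⟩ := hG.exists_meet_map hu (g := id)
    (S := ((lowerNeighbors G r v).erase u : Finset V)) hS Function.injective_id.injOn
    (fun x hx => Finset.ne_of_mem_erase hx)
  have h := Finset.card_le_card_of_injOn z
    (fun x hx => mem_lowerNeighbors.2 (hzb x hx).1) hz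
  rw [← Finset.card_erase_add_one (mem_lowerNeighbors.2 hu)]
  omega

/-- The numbers of lower neighbours take every value below one that is taken. -/
theorem IsMedianGraph.exists_card_lowerNeighbors_eq (hG : IsMedianGraph G) {r : V} {i : ℕ} :
    ∀ v, i < (lowerNeighbors G r v).card → ∃ u, (lowerNeighbors G r u).card = i := by
  intro v
  induction hd : G.dist r v using Nat.strong_induction_on generalizing v with
  | _ d ih =>
  intro hv
  obtain ⟨u, hu⟩ := Finset.card_pos.1 (Nat.zero_lt_of_lt hv)
  rw [mem_lowerNeighbors] at hu
  have h1 := hG.card_lowerNeighbors_le hu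
  rcases (show i ≤ (lowerNeighbors G r u).card by omega).eq_or_lt with h | h
  · exact ⟨u, h.symm⟩
  · exact ih _ (by have := hu.2; omega) u rfl h

/-- The sum of binomials counting the cubes is positive exactly when one of its terms is. -/
theorem IsMedianGraph.isIndContained_hypercube_iff (hG : IsMedianGraph G) (r : V) (n : ℕ) :
    (hypercube n).IsIndContained G ↔ ∃ v, n ≤ (lowerNeighbors G r v).card := by
  have hpos : 0 < cubeCount G n ↔ ∃ v, n ≤ (lowerNeighbors G r v).card := by
    rw [hG.cubeCount_eq r, Finset.sum_pos_iff]
    simp only [Finset.mem_univ, true_and, pos_iff_ne_zero, Ne, Nat.choose_eq_zero_iff, not_lt]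
  rw [← hpos, cubeCount, Set.ncard_pos (Set.toFinite _)]
  constructor
  · rintro ⟨φ⟩
    exact ⟨_, nonempty_induce_iso_iff.2 ⟨φ, rfl⟩⟩
  · rintro ⟨s, hs⟩
    obtain ⟨φ, -⟩ := nonempty_induce_iso_iff.1 hs
    exact ⟨φ⟩

end Count

/-! ### Comparison of binomial sums -/

theorem Nat.choose_succ_le_choose {n k : ℕ} (h : n ≤ 2 * k + 1) :
    n.choose (k + 1) ≤ n.choose k := by
  refine Nat.le_of_mul_le_mul_right ?_ (Nat.succ_pos k)
  rw [Nat.succ_eq_add_one, Nat.choose_succ_right_eq]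
  exact Nat.mul_le_mul_left _ (by omega)

theorem corollary4p14 {V : Type*} [Finite V] (G : SimpleGraph V) (hG : IsMedianGraph G)
    (m : ℕ) (hm : IsMaxCubeDim G m) :
    StrictAntiOn (cubeCount G) (Set.Icc ⌈((m : ℚ) - 1) / 2⌉₊ m) := by
  have := Fintype.ofFinite V
  obtain ⟨r⟩ : Nonempty V := hm.1.elim fun φ => ⟨φ fun _ => false⟩
  have hle : ∀ v, (lowerNeighbors G r v).card ≤ m := fun v =>
    hm.2 ((hG.isIndContained_hypercube_iff r _).2 ⟨v, le_rfl⟩)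
  obtain ⟨v, hv⟩ := (hG.isIndContained_hypercube_iff r m).1 hm.1
  apply strictAntiOn_of_add_one_lt Set.ordConnected_Icc
  intro i _ hi hi'
  -- The lower end of the interval enters only here, as the condition for binomials to be
  -- non-increasing from `i` to `i + 1`.
  have hmi : m ≤ 2 * i + 1 := by
    have h := Nat.ceil_le.1 hi.1
    have h' : (m : ℚ) ≤ 2 * i + 1 := by linarith
    exact_mod_cast h'
  have him : i + 1 ≤ m := hi'.2
  rw [hG.cubeCount_eq r, hG.cubeCount_eq r]
  -- The term of `u` is strict, since C(i, i+1) = 0 < 1 = C(i, i).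
  obtain ⟨u, hu⟩ := hG.exists_card_lowerNeighbors_eq v (Nat.lt_of_lt_of_le him hv)
  refine Finset.sum_lt_sum (fun x _ => Nat.choose_succ_le_choose ((hle x).trans hmi))
    ⟨u, Finset.mem_univ u, ?_⟩
  rw [hu, Nat.choose_self]
  exact (Nat.choose_succ_self i).trans_lt Nat.one_pos
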